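/- Let $(G,M,I)$ be a context, i.e. $G$ and $M$ are sets and $I\subseteq G\times M$ (write $gIm$ for $(g,m)\in I$). For $\sigma\subseteq G$ put $\sigma'=\{m\in M: gIm\text{ for all }g\in\sigma\}$. The Dowker complex $D(G,M,I)$ is the abstract simplicial complex whose simplices are the nonempty finite $\sigma\subseteq G$ that are contained in $\{g\in G: gIm\}$ for some $m\in M$; $D(M,G,I^T)$ is the Dowker complex of the transposed relation, with simplices in $M$. Let $C^\Delta$ be the functor taking an abstract simplicial complex to its (oriented) simplicial chain complex with coefficients in $\mathbb R$. The Dowker cosheaf $\mathcal R=\mathrm{CoShvRep}(G,M,I)$ on the face poset of $D(G,M,I)$ has costalks $\mathcal R(\sigma)=D(\sigma',\sigma,I^T|_{\sigma,\sigma'})$, and for $\sigma\subseteq\tau$ its extension $\mathcal R(\tau)\to\mathcal R(\sigma)$ is the simplicial map given by the inclusion $\tau'\hookrightarrow\sigma'$. Put $\mathcal R_\bullet=C^\Delta\circ\mathcal R$, a cosheaf of chain complexes. Fix any total order of $G$ to orient the simplices of $D(G,M,I)$. The cosheaf chain complex of $\mathcal R_\bullet$ has $\bigoplus_{\dim\sigma=k}\mathcal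 R_\bullet(\sigma)$ in degree $k$, and its boundary on the summand of $\sigma=[g_0<\dots<g_k]$ is $\sum_i(-1)^i$ times the extension to $\mathcal R_\bullet([g_0,\dots,\widehat{g_i},\dots,g_k])$. It is a chain complex of chain complexes, so its zeroth homology $H_0(\mathcal R_\bullet)$, the zeroth cosheaf homology, is a chain complex of real vector spaces. Then there is an isomorphism of chain complexes $$\varphi: H_0(\mathcal R_\bullet)\;\cong\; C^\Delta\bigl(D(M,G,I^T)\bigr)$$ whose composite with the natural map $\mathcal R_\bullet([g])\to H_0(\mathcal R_\bullet)$ is, for every vertex $g$ of $D(G,M,I)$, the chain map induced by the inclusion $\mathcal R([g])\hookrightarrow D(M,G,I^T)$. Consequently, for every $n\ge 0$, the map $\varphi$ induces an isomorphism $$H_n\bigl(H_0(\mathcal R_\bullet)\bigr)\;\cong\; H_n\bigl(D(M,G,I^T);\mathbb R\bigr),$$ that is, the homology of the zeroth cosheaf homology of $\mathcal R_\bullet$ is the simplicial homology of the dual Dowker complex. -/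

import Mathlib

open CategoryTheory CategoryTheory.Limits

universe u

noncomputable section

namespace DowkerCosheaf

/-! ### Abstract simplicial complexes and simplicial maps -/

/-- An abstract simplicial complex together with its vertex set (not every vertex has to span a
simplex). The simplices are nonempty finite sets of vertices. -/
structure Asc : Type (u + 1) where
  /-- the vertex set -/
  V : Type u
  /-- the simplices -/
  K : PreAbstractSimplicialComplex V

namespace Asc

open Classical in
/-- A simplicial map: a map of vertices that sends simplices to simplices
(after removal of duplicate vertices). -/
@[ext]
structure Hom (X Y : Asc.{u}) : Type u where
  /-- the map on vertices -/
  toFun : X.V → Y.V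
  map_faces : ∀ s ∈ X.K.faces, s.image toFun ∈ Y.K.faces

/-- The category of abstract simplicial complexes and simplicial maps. -/
instance : Category Asc.{u} where
  Hom := Hom
  id X := ⟨id, fun s hs => by simpa using hs⟩
  comp f g := ⟨g.toFun ∘ f.toFun, fun s hs => by
    classical
    rw [← Finset.image_image]
    exact g.map_faces _ (f.map_faces s hs)⟩

@[simp] theorem id_toFun (X : Asc.{u}) : Hom.toFun (𝟙 X) = id := rfl

@[simp] theorem comp_toFun {X Y Z : Asc.{u}} (f : X ⟶ Y) (g : Y ⟶ Z) :
    Hom.toFun (f ≫ g) = Hom.toFun g ∘ Hom.toFun f := rfl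

end Asc

/-! ### A sign cancellation that gives `∂ ∘ ∂ = 0` -/

theorem succAbove_comp_succAbove {n : ℕ} (i : Fin (n + 2)) (j : Fin (n + 3))
    (h : (j : ℕ) ≤ i) (x : Fin (n + 1)) :
    j.succAbove (i.succAbove x) =
      i.succ.succAbove ((Fin.castLT j (lt_of_le_of_lt h i.is_lt)).succAbove x) := by
  ext
  simp only [Fin.succAbove, Fin.lt_def, Fin.val_castSucc, Fin.val_succ, Fin.val_castLT]
  split_ifs <;> simp_all <;> omega

theorem sum_sum_faces_eq_zero {A : Type*} [AddCommGroup A] {n : ℕ}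
    (φ : Fin (n + 3) → Fin (n + 2) → A)
    (hφ : ∀ (i : Fin (n + 2)) (j : Fin (n + 3)) (h : (j : ℕ) ≤ i),
      φ j i = φ i.succ (Fin.castLT j (lt_of_le_of_lt h i.is_lt))) :
    ∑ j : Fin (n + 3), ∑ i : Fin (n + 2), ((-1 : ℤ) ^ (j : ℕ) * (-1) ^ (i : ℕ)) • φ j i = 0 := by
  rw [Finset.sum_comm]
  simp only [← Finset.sum_product']
  let P := Fin (n + 2) × Fin (n + 3)
  let S : Finset P := {ij : P | (ij.2 : ℕ) ≤ (ij.1 : ℕ)}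
  rw [Finset.univ_product_univ, ← Finset.sum_add_sum_compl S, ← eq_neg_iff_add_eq_zero,
    ← Finset.sum_neg_distrib]
  let ψ : ∀ ij : P, ij ∈ S → P := fun ij hij =>
    (Fin.castLT ij.2 (lt_of_le_of_lt (Finset.mem_filter.mp hij).right (Fin.is_lt ij.1)), ij.1.succ)
  apply Finset.sum_bij ψ
  · intro ij hij
    simp_rw [S, ψ, Finset.compl_filter, Finset.mem_filter_univ, Fin.val_succ,
      Fin.val_castLT] at hij ⊢
    lia
  · rintro ⟨i, j⟩ hij ⟨i', j'⟩ hij' h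
    rw [Prod.mk_inj]
    exact ⟨by simpa [ψ] using! congr_arg Prod.snd h,
      by simpa [ψ, Fin.castSucc_castLT] using! congr_arg Fin.castSucc (congr_arg Prod.fst h)⟩
  · rintro ⟨i', j'⟩ hij'
    simp_rw [S, Finset.compl_filter, Finset.mem_filter_univ, not_le] at hij'
    refine ⟨(j'.pred <| ?_, Fin.castSucc i'), ?_, ?_⟩
    · rintro rfl
      simp only [Fin.val_zero, not_lt_zero] at hij'
    · simpa [S] using! Nat.le_sub_one_of_lt hij'
    · simp only [ψ, Fin.castLT_castSucc, Fin.succ_pred]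
  · rintro ⟨i, j⟩ hij
    have hij2 : (j : ℕ) ≤ i := (Finset.mem_filter.mp hij).right
    dsimp only [ψ]
    rw [hφ i j hij2, ← neg_smul]
    congr 1
    simp only [Fin.val_succ, Fin.val_castLT]
    ring

/-! ### The simplicial chain complex (oriented chains, real coefficients) -/

section Chains

variable {V : Type u}

open Classical in
/-- Ordered `n`-simplices of `K`: `(n+1)`-tuples of vertices, possibly with repetitions, whose
entries span a simplex of `K`. -/
def OrderedSimplex (K : PreAbstractSimplicialComplex V) (n : ℕ) : Type u :=
  {t : Fin (n + 1) → V // Finset.univ.image t ∈ K.faces}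

namespace OrderedSimplex

variable {K : PreAbstractSimplicialComplex V} {n : ℕ}

/-- Reordering of the vertices. -/
def perm (t : OrderedSimplex K n) (π : Equiv.Perm (Fin (n + 1))) : OrderedSimplex K n :=
  ⟨t.1 ∘ π, by
    classical
    have h : Finset.univ.image (t.1 ∘ π) = Finset.univ.image t.1 := by
      rw [← Finset.image_image]; simp
    convert t.2⟩

/-- Removal of the `i`-th vertex. -/
def face (t : OrderedSimplex K (n + 1)) (i : Fin (n + 2)) : OrderedSimplex K n :=
  ⟨t.1 ∘ i.succAbove, by
    classical
    refine (K.isRelLowerSet_faces t.2).2 ?_ (by simp)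
    intro x hx
    simp only [Finset.mem_image, Finset.mem_univ, true_and, Function.comp_apply] at hx ⊢
    obtain ⟨a, rfl⟩ := hx
    exact ⟨_, rfl⟩⟩

/-- The image under a simplicial map. -/
def map {X Y : Asc.{u}} (f : X ⟶ Y) (t : OrderedSimplex X.K n) : OrderedSimplex Y.K n :=
  ⟨Asc.Hom.toFun f ∘ t.1, by
    classical
    rw [← Finset.image_image]
    convert Asc.Hom.map_faces f _ t.2⟩

end OrderedSimplex

/-- The orientation relations: reordering the vertices by `π` multiplies a simplex by the sign
of `π`. In particular simplices with a repeated vertex become zero. -/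
def orientationRel (K : PreAbstractSimplicialComplex V) (n : ℕ) :
    Submodule ℝ (OrderedSimplex K n →₀ ℝ) :=
  Submodule.span ℝ {x | ∃ (t : OrderedSimplex K n) (π : Equiv.Perm (Fin (n + 1))),
    x = Finsupp.single (t.perm π) 1 - ((Equiv.Perm.sign π : ℤ) : ℝ) • Finsupp.single t 1}

/-- The real vector space of oriented simplicial `n`-chains of `K`. -/
abbrev OrientedChains (K : PreAbstractSimplicialComplex V) (n : ℕ) : Type u :=
  (OrderedSimplex K n →₀ ℝ) ⧸ orientationRel K n

/-- The oriented simplex `[t 0, …, t n]` as a chain. -/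
def orientedSimplex {K : PreAbstractSimplicialComplex V} {n : ℕ} (t : OrderedSimplex K n) :
    OrientedChains K n :=
  (orientationRel K n).mkQ (Finsupp.single t 1)

theorem orientedSimplex_perm {K : PreAbstractSimplicialComplex V} {n : ℕ}
    (t : OrderedSimplex K n) (π : Equiv.Perm (Fin (n + 1))) :
    orientedSimplex (t.perm π) = ((Equiv.Perm.sign π : ℤ) : ℝ) • orientedSimplex t := by
  unfold orientedSimplex
  rw [← map_smul, ← sub_eq_zero, ← map_sub, Submodule.mkQ_apply, Submodule.Quotient.mk_eq_zero]
  exact Submodule.subset_span ⟨t, π, rfl⟩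

/-- Linear maps out of the oriented chains, by prescribing the values on oriented simplices. -/
def chainsLift {K : PreAbstractSimplicialComplex V} {n : ℕ} {A : Type*} [AddCommGroup A]
    [Module ℝ A] (φ : OrderedSimplex K n → A)
    (hφ : ∀ t π, φ (t.perm π) = ((Equiv.Perm.sign π : ℤ) : ℝ) • φ t) :
    OrientedChains K n →ₗ[ℝ] A :=
  (orientationRel K n).liftQ (Finsupp.linearCombination ℝ φ) (by
    rw [orientationRel, Submodule.span_le]
    rintro _ ⟨t, π, rfl⟩
    simp [hφ])

@[simp] theorem chainsLift_orientedSimplex {K : PreAbstractSimplicialComplex V} {n : ℕ}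
    {A : Type*} [AddCommGroup A] [Module ℝ A] (φ : OrderedSimplex K n → A)
    (hφ : ∀ t π, φ (t.perm π) = ((Equiv.Perm.sign π : ℤ) : ℝ) • φ t) (t : OrderedSimplex K n) :
    chainsLift φ hφ (orientedSimplex t) = φ t := by
  simp [chainsLift, orientedSimplex]

theorem chains_hom_ext {K : PreAbstractSimplicialComplex V} {n : ℕ} {A : Type*} [AddCommGroup A]
    [Module ℝ A] {f g : OrientedChains K n →ₗ[ℝ] A}
    (h : ∀ t, f (orientedSimplex t) = g (orientedSimplex t)) : f = g := by
  refine Submodule.linearMap_qext _ (Finsupp.lhom_ext' fun t => LinearMap.ext_ring ?_)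
  exact h t

/-- The alternating sum of the faces of an ordered simplex. -/
def boundaryFun {K : PreAbstractSimplicialComplex V} {n : ℕ} (t : OrderedSimplex K (n + 1)) :
    OrientedChains K n :=
  ∑ i : Fin (n + 2), (-1 : ℤ) ^ (i : ℕ) • orientedSimplex (t.face i)

theorem swap_succAbove_castSucc {n : ℕ} (i x : Fin (n + 1)) :
    Equiv.swap i.castSucc i.succ (i.castSucc.succAbove x) = i.succ.succAbove x := by
  obtain ⟨i, hi⟩ := i
  obtain ⟨x, hx⟩ := x
  simp only [Fin.succAbove, Equiv.swap_apply_def, Fin.lt_def, Fin.ext_iff, Fin.castSucc_mk,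
    Fin.succ_mk]
  split_ifs <;> simp_all only <;> omega

theorem swap_succAbove_succ {n : ℕ} (i x : Fin (n + 1)) :
    Equiv.swap i.castSucc i.succ (i.succ.succAbove x) = i.castSucc.succAbove x := by
  rw [← swap_succAbove_castSucc, Equiv.swap_apply_self]

theorem boundaryFun_perm_adjacent {K : PreAbstractSimplicialComplex V} {n : ℕ}
    (t : OrderedSimplex K (n + 1)) (i : Fin (n + 1)) :
    boundaryFun (t.perm (Equiv.swap i.castSucc i.succ)) = -boundaryFun t := by
  have hne : i.castSucc ≠ i.succ := by simp [Fin.ext_iff]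
  unfold boundaryFun
  rw [← Finset.sum_neg_distrib,
    ← Equiv.sum_comp (Equiv.swap i.castSucc i.succ)
      (fun j => -((-1 : ℤ) ^ (j : ℕ) • orientedSimplex (t.face j)))]
  refine Finset.sum_congr rfl fun j _ => ?_
  by_cases h1 : j = i.castSucc
  · subst h1
    rw [Equiv.swap_apply_left]
    have : (t.perm (Equiv.swap i.castSucc i.succ)).face i.castSucc = t.face i.succ := by
      apply Subtype.ext
      funext x
      simp only [OrderedSimplex.face, OrderedSimplex.perm, Function.comp_apply]
      rw [swap_succAbove_castSucc]
    rw [this, Fin.val_succ, Fin.val_castSucc, pow_succ]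
    simp
  by_cases h2 : j = i.succ
  · subst h2
    rw [Equiv.swap_apply_right]
    have : (t.perm (Equiv.swap i.castSucc i.succ)).face i.succ = t.face i.castSucc := by
      apply Subtype.ext
      funext x
      simp only [OrderedSimplex.face, OrderedSimplex.perm, Function.comp_apply]
      rw [swap_succAbove_succ]
    rw [this, Fin.val_succ, Fin.val_castSucc, pow_succ]
    simp
  rw [Equiv.swap_apply_of_ne_of_ne h1 h2]
  obtain ⟨a, ha⟩ := Fin.exists_succAbove_eq (Ne.symm h1)
  obtain ⟨b, hb⟩ := Fin.exists_succAbove_eq (Ne.symm h2)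
  have hab : a ≠ b := by
    rintro rfl
    exact hne (ha.symm.trans hb)
  have : (t.perm (Equiv.swap i.castSucc i.succ)).face j = (t.face j).perm (Equiv.swap a b) := by
    apply Subtype.ext
    funext x
    simp only [OrderedSimplex.face, OrderedSimplex.perm, Function.comp_apply]
    rw [← ha, ← hb, Function.Injective.swap_apply (Fin.succAbove_right_injective)]
  rw [this, orientedSimplex_perm, Equiv.Perm.sign_swap hab]
  simp

theorem boundaryFun_perm {K : PreAbstractSimplicialComplex V} {n : ℕ}
    (t : OrderedSimplex K (n + 1)) (π : Equiv.Perm (Fin (n + 2))) :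
    boundaryFun (t.perm π) = ((Equiv.Perm.sign π : ℤ) : ℝ) • boundaryFun t := by
  have hπ : π ∈ Submonoid.closure
      (Set.range fun i : Fin (n + 1) => Equiv.swap i.castSucc i.succ) := by
    rw [Equiv.Perm.mclosure_swap_castSucc_succ]; trivial
  induction hπ using Submonoid.closure_induction generalizing t with
  | mem x hx =>
    obtain ⟨i, rfl⟩ := hx
    rw [boundaryFun_perm_adjacent, Equiv.Perm.sign_swap (by simp [Fin.ext_iff])]
    simp
  | one =>
    have : t.perm 1 = t := rfl
    rw [this]
    simp
  | mul x y _ _ hx hy =>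
    have : t.perm (x * y) = (t.perm x).perm y := rfl
    rw [this, hy, hx, smul_smul, Equiv.Perm.sign_mul]
    congr 1
    push_cast
    ring

/-- The simplicial boundary
`∂ [v₀, …, vₙ₊₁] = ∑ i, (-1)^i [v₀, …, v̂ᵢ, …, vₙ₊₁]`. -/
def boundary (K : PreAbstractSimplicialComplex V) (n : ℕ) :
    OrientedChains K (n + 1) →ₗ[ℝ] OrientedChains K n :=
  chainsLift boundaryFun boundaryFun_perm

theorem boundary_orientedSimplex {K : PreAbstractSimplicialComplex V} {n : ℕ}
    (t : OrderedSimplex K (n + 1)) :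
    boundary K n (orientedSimplex t) =
      ∑ i : Fin (n + 2), (-1 : ℤ) ^ (i : ℕ) • orientedSimplex (t.face i) := by
  simp [boundary, boundaryFun]

theorem boundary_comp_boundary (K : PreAbstractSimplicialComplex V) (n : ℕ) :
    boundary K n ∘ₗ boundary K (n + 1) = 0 := by
  refine chains_hom_ext fun t => ?_
  simp only [LinearMap.comp_apply, boundary_orientedSimplex, map_sum, map_zsmul,
    LinearMap.zero_apply, Finset.smul_sum, smul_smul]
  refine sum_sum_faces_eq_zero (fun j i => orientedSimplex ((t.face j).face i)) fun i j h => ?_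
  congr 1
  apply Subtype.ext
  funext x
  exact congrArg t.1 (succAbove_comp_succAbove i j h x)

/-- The linear map on chains induced by a simplicial map. -/
def chainsMap {X Y : Asc.{u}} (f : X ⟶ Y) (n : ℕ) :
    OrientedChains X.K n →ₗ[ℝ] OrientedChains Y.K n :=
  chainsLift (fun t => orientedSimplex (t.map f)) fun t π => orientedSimplex_perm (t.map f) π

@[simp] theorem chainsMap_orientedSimplex {X Y : Asc.{u}} (f : X ⟶ Y) {n : ℕ}
    (t : OrderedSimplex X.K n) :
    chainsMap f n (orientedSimplex t) = orientedSimplex (t.map f) :=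
  chainsLift_orientedSimplex _ _ t

theorem chainsMap_comp_boundary {X Y : Asc.{u}} (f : X ⟶ Y) (n : ℕ) :
    boundary Y.K n ∘ₗ chainsMap f (n + 1) = chainsMap f n ∘ₗ boundary X.K n := by
  refine chains_hom_ext fun t => ?_
  simp only [LinearMap.comp_apply, chainsMap_orientedSimplex, boundary_orientedSimplex, map_sum,
    map_zsmul]
  rfl

/-- The functor `C^Δ` that takes an abstract simplicial complex to its simplicial chain complex
with real coefficients. -/
def simplicialChains : Asc.{u} ⥤ ChainComplex (ModuleCat.{u} ℝ) ℕ where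
  obj X := ChainComplex.of (fun n => ModuleCat.of ℝ (OrientedChains X.K n))
    (fun n => ModuleCat.ofHom (boundary X.K n))
    (fun n => by rw [← ModuleCat.ofHom_comp, boundary_comp_boundary]; rfl)
  map {X Y} f := ChainComplex.ofHom (fun n => ModuleCat.ofHom (chainsMap f n))
    (fun n => by
      dsimp only
      rw [ChainComplex.of_d, ChainComplex.of_d]
      exact congrArg ModuleCat.ofHom (chainsMap_comp_boundary f n))
  map_id X := by
    ext n : 1
    refine ModuleCat.hom_ext (chains_hom_ext fun t => ?_)
    exact chainsMap_orientedSimplex (𝟙 X) t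
  map_comp {X Y Z} f g := by
    ext n : 1
    refine ModuleCat.hom_ext (chains_hom_ext fun t => ?_)
    change chainsMap (f ≫ g) n (orientedSimplex t) =
      chainsMap g n (chainsMap f n (orientedSimplex t))
    simp only [chainsMap_orientedSimplex]
    rfl

end Chains

/-! ### Cosheaves on simplicial complexes and cosheaf homology -/

section Cosheaf

variable {V : Type u}

/-- The face poset of a simplicial complex: its simplices, ordered by inclusion. -/
abbrev FacePoset (K : PreAbstractSimplicialComplex V) : Type u := {s : Finset V // s ∈ K.faces}

/-- A cosheaf on a poset `P` with values in `C`: an object for every `x : P` and an extension map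
from the costalk at `y` to the costalk at `x` for `x ≤ y`, compatible with composition. -/
abbrev Cosheaf (P : Type u) [PartialOrder P] (C : Type*) [Category* C] := Pᵒᵖ ⥤ C

variable [LinearOrder V]

/-- The `n`-simplices of `K`, each written with its vertices in increasing order. -/
def Simplex (K : PreAbstractSimplicialComplex V) (n : ℕ) : Type u :=
  {f : Fin (n + 1) ↪o V // Finset.univ.map f.toEmbedding ∈ K.faces}

namespace Simplex

variable {K : PreAbstractSimplicialComplex V} {n : ℕ}

/-- The set of vertices, as an element of the face poset. -/
def toFace (σ : Simplex K n) : FacePoset K := ⟨Finset.univ.map σ.1.toEmbedding, σ.2⟩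

/-- Removal of the `i`-th vertex. -/
def face (σ : Simplex K (n + 1)) (i : Fin (n + 2)) : Simplex K n :=
  ⟨(Fin.succAboveOrderEmb i).trans σ.1, by
    refine (K.isRelLowerSet_faces σ.2).2 ?_ (by simp)
    intro x hx
    simp only [Finset.mem_map, Finset.mem_univ, true_and] at hx ⊢
    obtain ⟨a, rfl⟩ := hx
    exact ⟨i.succAbove a, rfl⟩⟩

theorem toFace_face_le (σ : Simplex K (n + 1)) (i : Fin (n + 2)) :
    (σ.face i).toFace ≤ σ.toFace := by
  intro x hx
  simp only [toFace, face, Finset.mem_map, Finset.mem_univ, true_and] at hx ⊢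
  obtain ⟨a, rfl⟩ := hx
  exact ⟨i.succAbove a, rfl⟩

end Simplex

variable {C : Type*} [Category.{u} C] [Preadditive C] [HasCoproducts.{u} C]
variable {K : PreAbstractSimplicialComplex V}

/-- Cosheaf `n`-chains: the direct sum of the costalks over all `n`-simplices. -/
def cosheafChains (F : Cosheaf (FacePoset K) C) (n : ℕ) : C :=
  ∐ fun σ : Simplex K n => F.obj (Opposite.op σ.toFace)

/-- The inclusion of the costalk at `σ` as a direct summand of the chains. -/
def cosheafChainsι (F : Cosheaf (FacePoset K) C) {n : ℕ} (σ : Simplex K n) :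
    F.obj (Opposite.op σ.toFace) ⟶ cosheafChains F n :=
  Sigma.ι (fun σ : Simplex K n => F.obj (Opposite.op σ.toFace)) σ

/-- The extension map along `τ ⊆ σ` followed by the inclusion of the costalk at `τ`. -/
def cosheafExtend (F : Cosheaf (FacePoset K) C) {n : ℕ} {x : FacePoset K} (τ : Simplex K n)
    (h : τ.toFace ≤ x) : F.obj (Opposite.op x) ⟶ cosheafChains F n :=
  F.map (homOfLE h).op ≫ cosheafChainsι F τ

/-- The cosheaf boundary: on the costalk at `σ = [v₀ < … < vₙ₊₁]` it is
`∑ i, (-1)^i` times the extension to the costalk at `[v₀, …, v̂ᵢ, …, vₙ₊₁]`. -/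
def cosheafBoundary (F : Cosheaf (FacePoset K) C) (n : ℕ) :
    cosheafChains F (n + 1) ⟶ cosheafChains F n :=
  Sigma.desc fun σ => ∑ i : Fin (n + 2),
    (-1 : ℤ) ^ (i : ℕ) • cosheafExtend F (σ.face i) (σ.toFace_face_le i)

theorem ι_cosheafBoundary (F : Cosheaf (FacePoset K) C) {n : ℕ} (σ : Simplex K (n + 1)) :
    cosheafChainsι F σ ≫ cosheafBoundary F n = ∑ i : Fin (n + 2),
      (-1 : ℤ) ^ (i : ℕ) • cosheafExtend F (σ.face i) (σ.toFace_face_le i) :=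
  Sigma.ι_desc _ _

theorem cosheafBoundary_comp (F : Cosheaf (FacePoset K) C) (n : ℕ) :
    cosheafBoundary F (n + 1) ≫ cosheafBoundary F n = 0 := by
  refine Sigma.hom_ext _ _ fun σ => ?_
  refine Eq.trans ?_ comp_zero.symm
  change cosheafChainsι F σ ≫ cosheafBoundary F (n + 1) ≫ cosheafBoundary F n = 0
  rw [← Category.assoc, ι_cosheafBoundary, Preadditive.sum_comp]
  have key : ∀ (j : Fin (n + 3)) (i : Fin (n + 2)),
      F.map (homOfLE (σ.toFace_face_le j)).op ≫
        cosheafExtend F ((σ.face j).face i) ((σ.face j).toFace_face_le i) =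
      cosheafExtend F ((σ.face j).face i)
        (((σ.face j).toFace_face_le i).trans (σ.toFace_face_le j)) := by
    intro j i
    unfold cosheafExtend
    rw [← Category.assoc, ← F.map_comp]
    rfl
  simp only [Preadditive.zsmul_comp, cosheafExtend, Category.assoc, ι_cosheafBoundary,
    Preadditive.comp_sum, Preadditive.comp_zsmul, Finset.smul_sum, smul_smul]
  refine (Finset.sum_congr rfl fun j _ => Finset.sum_congr rfl fun i _ => ?_).trans
    (sum_sum_faces_eq_zero (fun j i => cosheafExtend F ((σ.face j).face i)
      (((σ.face j).toFace_face_le i).trans (σ.toFace_face_le j))) ?_)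
  · rw [← key]
    rfl
  · intro i j h
    have hf : (σ.face j).face i =
        (σ.face i.succ).face (Fin.castLT j (lt_of_le_of_lt h i.is_lt)) := by
      apply Subtype.ext
      ext x
      exact congrArg σ.1 (succAbove_comp_succAbove i j h x)
    have gen : ∀ (τ τ' : Simplex K n) (h : τ.toFace ≤ σ.toFace) (h' : τ'.toFace ≤ σ.toFace),
        τ = τ' → cosheafExtend F τ h = cosheafExtend F τ' h' := by
      rintro τ _ h h' rfl
      rfl
    exact gen _ _ _ _ hf

/-- The cosheaf chain complex of a cosheaf on (the face poset of) a simplicial complex. For a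
cosheaf of chain complexes it is a chain complex of chain complexes, i.e. a double complex. -/
def cosheafComplex (F : Cosheaf (FacePoset K) C) : ChainComplex C ℕ :=
  ChainComplex.of (cosheafChains F) (cosheafBoundary F) (cosheafBoundary_comp F)

/-- The `n`-th cosheaf homology. -/
def cosheafHomology [CategoryWithHomology C] (F : Cosheaf (FacePoset K) C) (n : ℕ) : C :=
  (cosheafComplex F).homology n

/-- The canonical map from the costalk at a vertex to the zeroth cosheaf homology: the costalk is
a summand of the `0`-chains, all of which are cycles. -/
def costalkToHomologyZero [CategoryWithHomology C] (F : Cosheaf (FacePoset K) C)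
    (v : Simplex K 0) : F.obj (Opposite.op v.toFace) ⟶ cosheafHomology F 0 :=
  (cosheafComplex F).liftCycles (i := 0) (cosheafChainsι F v) _ rfl
    (by rw [(cosheafComplex F).shape _ _ (by simp)]; exact comp_zero) ≫
  (cosheafComplex F).homologyπ 0

end Cosheaf

/-! ### Dowker complexes and the Dowker cosheaf -/

section Dowker

variable {G M : Type u}

/-- The hypergraph of a context `(G, M, I)`: its vertices are the objects and its hyperedges are
the sets `{m}' = {g | g I m}`. -/
def hypRep (I : G → M → Prop) : Set (Set G) := Set.range fun m => lowerPolar I {m}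

/-- The Dowker complex of a hypergraph: the (nonempty finite) subsets of hyperedges. -/
def hypergraphDowker {V : Type u} (E : Set (Set V)) : PreAbstractSimplicialComplex V where
  faces := {s | s.Nonempty ∧ ∃ e ∈ E, (s : Set V) ⊆ e}
  isRelLowerSet_faces := by
    rintro s ⟨hs, e, he, hse⟩
    exact ⟨hs, fun t hts ht => ⟨ht, e, he, (Finset.coe_subset.2 hts).trans hse⟩⟩

/-- The Dowker complex `D(G, M, I)` of a context. -/
def dowker (I : G → M → Prop) : PreAbstractSimplicialComplex G := hypergraphDowker (hypRep I)

theorem mem_dowker {I : G → M → Prop} {s : Finset G} :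
    s ∈ (dowker I).faces ↔ s.Nonempty ∧ ∃ m, ∀ g ∈ s, I g m := by
  simp [dowker, hypergraphDowker, hypRep, lowerPolar, Set.subset_def]

/-- The Dowker complex `D(G, M, I)` with vertex set `G`. -/
def dowkerAsc (I : G → M → Prop) : Asc.{u} := ⟨G, dowker I⟩

/-- The costalk `D(σ', σ, Iᵀ|)` of the Dowker cosheaf; here
`σ' = upperPolar I σ = {m | ∀ g ∈ σ, g I m}`. -/
def costalk (I : G → M → Prop) (σ : FacePoset (dowker I)) : Asc.{u} :=
  dowkerAsc fun (m : upperPolar I (σ.1 : Set G)) (g : (σ.1 : Set G)) => I g m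

/-- The inclusion `τ' → σ'` for `σ ⊆ τ`. -/
def polarInclusion (I : G → M → Prop) {σ τ : FacePoset (dowker I)} (h : σ ≤ τ) :
    upperPolar I (τ.1 : Set G) → upperPolar I (σ.1 : Set G) :=
  fun m => ⟨m.1, fun _ hg => m.2 (h hg)⟩

/-- The Dowker cosheaf `CoShvRep(G, M, I)`, a cosheaf of abstract simplicial complexes on the
Dowker complex `D(G, M, I)`. -/
def dowkerCosheaf (I : G → M → Prop) : Cosheaf (FacePoset (dowker I)) Asc.{u} where
  obj σ := costalk I σ.unop
  map {τ σ} f := ⟨polarInclusion I (leOfHom f.unop), by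
    intro s hs
    obtain ⟨hs, -⟩ := mem_dowker.1 hs
    obtain ⟨⟨g, hg⟩, -⟩ := mem_dowker.1 σ.unop.2
    classical
    refine mem_dowker.2 ⟨hs.image _, ⟨g, hg⟩, fun m _ => m.2 hg⟩⟩
  map_id _ := rfl
  map_comp _ _ := rfl

/-- The cosheaf of chain complexes `R_• = C^Δ ∘ CoShvRep(G, M, I)`. -/
def dowkerChainCosheaf (I : G → M → Prop) :
    Cosheaf (FacePoset (dowker I)) (ChainComplex (ModuleCat.{u} ℝ) ℕ) :=
  dowkerCosheaf I ⋙ simplicialChains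

/-- The transposed relation `Iᵀ`. -/
def transposeRel (I : G → M → Prop) : M → G → Prop := fun m g => I g m

/-- The inclusion of the costalk at `σ` into the dual Dowker complex `D(M, G, Iᵀ)`. -/
def costalkInclusion (I : G → M → Prop) (σ : FacePoset (dowker I)) :
    (dowkerCosheaf I).obj (Opposite.op σ) ⟶ dowkerAsc (transposeRel I) :=
  ⟨Subtype.val, by
    intro s hs
    obtain ⟨hs, ⟨g, hg⟩, h⟩ := mem_dowker.1 hs
    classical
    refine mem_dowker.2 ⟨hs.image _, g, fun m hm => ?_⟩
    obtain ⟨m', hm', rfl⟩ := Finset.mem_image.1 hm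
    exact h m' hm'⟩

end Dowker

end DowkerCosheaf

end

open DowkerCosheaf

/-! The zeroth cosheaf homology is the cokernel of the boundary on edges, so it is the sum of the
costalks at the vertices, glued along the edges. A map out of it is a family of maps on the vertex
costalks that agree after extension from every edge (`exists_homologyZero_desc`,
`homologyZero_hom_ext`). The inclusions into D(M, G, Iᵀ) form such a family, because both ends of an
edge yield the inclusion of the costalk at that edge. This gives φ.

For the inverse, a simplex t of D(M, G, Iᵀ) has some g related to all its vertices, so it lies in
the costalk at [g] and has a class in H₀. If h serves as well as g, then {g, h} is a simplex of D(G,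
M, I), with any vertex of t as witness, and t already lies in the costalk of that edge. Hence the
class does not depend on g (`homologyZeroClass_eq`). An object that serves t also serves its
reorderings and faces, so signs and boundaries can be checked inside a single costalk.

The two maps are mutually inverse because both complexes are generated by the vertex costalks
(`homologyZero_hom_ext`, `costalk_jointly_epi`), on which each composite is visibly the identity. -/

noncomputable section

namespace DowkerCosheaf

/-! ### The universal property of the zeroth cosheaf homology -/

section HomologyZero

variable {V : Type u} [LinearOrder V] {C : Type*} [Category.{u} C] [Preadditive C]
  [HasCoproducts.{u} C] [CategoryWithHomology C] {K : PreAbstractSimplicialComplex V}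

/-- The zeroth cosheaf homology, seen as the cokernel of the boundary. -/
def homologyZeroι (F : Cosheaf (FacePoset K) C) :
    cosheafHomology F 0 ⟶ (cosheafComplex F).opcycles 0 :=
  (cosheafComplex F).homologyι 0

instance (F : Cosheaf (FacePoset K) C) : IsIso (homologyZeroι F) :=
  (cosheafComplex F).isIso_homologyι 0 _ rfl ((cosheafComplex F).shape _ _ (by simp))

/-- The projection of the cosheaf `0`-chains onto the cokernel of the boundary. -/
def chainsZeroπ (F : Cosheaf (FacePoset K) C) :
    cosheafChains F 0 ⟶ (cosheafComplex F).opcycles 0 :=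
  (cosheafComplex F).pOpcycles 0

instance (F : Cosheaf (FacePoset K) C) : Epi (chainsZeroπ F) :=
  inferInstanceAs (Epi ((cosheafComplex F).pOpcycles 0))

omit [CategoryWithHomology C] in
theorem cosheafComplex_d (F : Cosheaf (FacePoset K) C) (n : ℕ) :
    (cosheafComplex F).d (n + 1) n = cosheafBoundary F n := by
  unfold cosheafComplex
  exact ChainComplex.of_d ..

theorem cosheafBoundary_chainsZeroπ (F : Cosheaf (FacePoset K) C) :
    cosheafBoundary F 0 ≫ chainsZeroπ F = 0 := by
  rw [← cosheafComplex_d]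
  exact (cosheafComplex F).d_pOpcycles 1 0

/-- Translates between the two descriptions of H₀: through cycles, as in `costalkToHomologyZero`,
and as a cokernel, where the universal property is available. -/
theorem costalkToHomologyZero_homologyZeroι (F : Cosheaf (FacePoset K) C) (v : Simplex K 0) :
    costalkToHomologyZero F v ≫ homologyZeroι F = cosheafChainsι F v ≫ chainsZeroπ F := by
  refine (Category.assoc _ _ _).trans ?_
  refine (congrArg _ ((cosheafComplex F).homology_π_ι 0)).trans ?_
  exact (cosheafComplex F).liftCycles_i_assoc _ _ _ _ _

/-- Maps out of the zeroth cosheaf homology are determined on the costalks at the vertices. -/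
theorem homologyZero_hom_ext (F : Cosheaf (FacePoset K) C) {A : C}
    {f g : cosheafHomology F 0 ⟶ A}
    (h : ∀ v, costalkToHomologyZero F v ≫ f = costalkToHomologyZero F v ≫ g) : f = g := by
  rw [← cancel_epi (inv (homologyZeroι F)), ← cancel_epi (chainsZeroπ F)]
  refine Sigma.hom_ext _ _ fun v => ?_
  change cosheafChainsι F v ≫ _ = cosheafChainsι F v ≫ _
  rw [← reassoc_of% (costalkToHomologyZero_homologyZeroι F),
    ← reassoc_of% (costalkToHomologyZero_homologyZeroι F),
    IsIso.hom_inv_id_assoc, IsIso.hom_inv_id_assoc, h]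

/-- The two ends of an edge induce the same map into the zeroth cosheaf homology. -/
theorem costalkToHomologyZero_edge (F : Cosheaf (FacePoset K) C) (e : Simplex K 1) :
    F.map (homOfLE (e.toFace_face_le 0)).op ≫ costalkToHomologyZero F (e.face 0) =
      F.map (homOfLE (e.toFace_face_le 1)).op ≫ costalkToHomologyZero F (e.face 1) := by
  rw [← cancel_mono (homologyZeroι F), Category.assoc, Category.assoc,
    costalkToHomologyZero_homologyZeroι, costalkToHomologyZero_homologyZeroι, ← sub_eq_zero]
  -- The boundary on the summand of `e` is the extension to face 0 minus the extension to face 1,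
  -- and it dies in the cokernel.
  have h : cosheafChainsι F e ≫ cosheafBoundary F 0 ≫ chainsZeroπ F = 0 := by
    rw [cosheafBoundary_chainsZeroπ, comp_zero]
  rw [← Category.assoc, ι_cosheafBoundary, Fin.sum_univ_two] at h
  simpa [cosheafExtend, sub_eq_add_neg] using h

/-- A family of maps on the costalks at the vertices that agree along edges descends to the zeroth
cosheaf homology. -/
theorem exists_homologyZero_desc (F : Cosheaf (FacePoset K) C) {A : C}
    (k : ∀ v : Simplex K 0, F.obj (Opposite.op v.toFace) ⟶ A)
    (hk : ∀ e : Simplex K 1, F.map (homOfLE (e.toFace_face_le 0)).op ≫ k (e.face 0) =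
      F.map (homOfLE (e.toFace_face_le 1)).op ≫ k (e.face 1)) :
    ∃ f : cosheafHomology F 0 ⟶ A, ∀ v, costalkToHomologyZero F v ≫ f = k v := by
  let d : cosheafChains F 0 ⟶ A := Sigma.desc k
  have hι : ∀ v, cosheafChainsι F v ≫ d = k v := fun v => Sigma.ι_desc _ _
  have hd : cosheafBoundary F 0 ≫ d = 0 := by
    refine Sigma.hom_ext _ _ fun e => ?_
    refine Eq.trans ?_ comp_zero.symm
    change cosheafChainsι F e ≫ cosheafBoundary F 0 ≫ d = 0
    rw [← Category.assoc, ι_cosheafBoundary, Fin.sum_univ_two]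
    simp [cosheafExtend, hι, hk e]
  rw [← cosheafComplex_d] at hd
  let q := (cosheafComplex F).descOpcycles d 1 (by simp) hd
  have hq : chainsZeroπ F ≫ q = d := (cosheafComplex F).p_descOpcycles _ _ _ _
  refine ⟨homologyZeroι F ≫ q, fun v => ?_⟩
  rw [reassoc_of% (costalkToHomologyZero_homologyZeroι F), hq, hι]

end HomologyZero

/-! ### Elementwise formulas for simplicial chains -/

theorem chainMap_d_apply {X Y : ChainComplex (ModuleCat.{u} ℝ) ℕ} (f : X ⟶ Y) (i j : ℕ)
    (x : X.X i) : (Y.d i j).hom ((f.f i).hom x) = (f.f j).hom ((X.d i j).hom x) :=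
  congrArg (fun h => h.hom x) (f.comm i j)

theorem simplicialChains_d (X : Asc.{u}) (n : ℕ) :
    (simplicialChains.obj X).d (n + 1) n = ModuleCat.ofHom (boundary X.K n) := by
  dsimp only [simplicialChains]
  rw [ChainComplex.of_d]

theorem simplicialChains_d_orientedSimplex {X : Asc.{u}} {n : ℕ}
    (t : OrderedSimplex X.K (n + 1)) :
    ((simplicialChains.obj X).d (n + 1) n).hom (orientedSimplex t) =
      ∑ i : Fin (n + 2), (-1 : ℤ) ^ (i : ℕ) • orientedSimplex (t.face i) := by
  rw [simplicialChains_d]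
  exact boundary_orientedSimplex t

theorem simplicialChains_map_orientedSimplex {X Y : Asc.{u}} (f : X ⟶ Y) {n : ℕ}
    (t : OrderedSimplex X.K n) :
    ((simplicialChains.map f).f n).hom (orientedSimplex t) = orientedSimplex (t.map f) :=
  chainsMap_orientedSimplex f t

/-! ### Classes of dual simplices in the zeroth cosheaf homology -/

section Dual

variable {G M : Type u} {I : G → M → Prop} {n : ℕ}

/-- An ordered simplex of the dual Dowker complex all of whose vertices are related to all
vertices of `σ`, as an ordered simplex of the costalk at `σ`. -/
def restrictToCostalk (σ : FacePoset (dowker I)) (t : OrderedSimplex (dowker (transposeRel I)) n)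
    (h : ∀ g ∈ σ.1, ∀ i, I g (t.1 i)) :
    OrderedSimplex ((dowkerCosheaf I).obj (Opposite.op σ)).K n :=
  ⟨fun i => ⟨t.1 i, fun _ hg => h _ hg i⟩, by
    classical
    obtain ⟨g, hg⟩ := (mem_dowker.1 σ.2).1
    exact mem_dowker.2 ⟨Finset.image_nonempty.2 Finset.univ_nonempty, ⟨g, hg⟩, fun m _ => m.2 hg⟩⟩

variable [LinearOrder G]

/-- The class in the zeroth cosheaf homology of a simplex in the costalk at a vertex. -/
def homologyZeroClass (v : Simplex (dowker I) 0)
    (t : OrderedSimplex (dowker (transposeRel I)) n) (h : ∀ g ∈ v.toFace.1, ∀ i, I g (t.1 i)) :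
    (cosheafHomology (dowkerChainCosheaf I) 0).X n :=
  ((costalkToHomologyZero (dowkerChainCosheaf I) v).f n).hom
    (orientedSimplex (restrictToCostalk v.toFace t h))

/-- The simplex `t` already lies in the costalk at the edge, and both sides are images of that one
chain, which the gluing relation identifies. -/
theorem homologyZeroClass_edge (e : Simplex (dowker I) 1)
    (t : OrderedSimplex (dowker (transposeRel I)) n) (h : ∀ g ∈ e.toFace.1, ∀ i, I g (t.1 i)) :
    homologyZeroClass (e.face 0) t (fun g hg => h g (e.toFace_face_le 0 hg)) =
      homologyZeroClass (e.face 1) t (fun g hg => h g (e.toFace_face_le 1 hg)) := by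
  have hmap : ∀ j, (((dowkerChainCosheaf I).map (homOfLE (e.toFace_face_le j)).op).f n).hom
      (orientedSimplex (restrictToCostalk e.toFace t h)) =
      orientedSimplex (restrictToCostalk (e.face j).toFace t
        (fun g hg => h g (e.toFace_face_le j hg))) := fun j =>
    simplicialChains_map_orientedSimplex
      ((dowkerCosheaf I).map (homOfLE (e.toFace_face_le j)).op) _
  refine (congrArg ((costalkToHomologyZero (dowkerChainCosheaf I) (e.face 0)).f n).hom
    (hmap 0).symm).trans (Eq.trans ?_
      (congrArg ((costalkToHomologyZero (dowkerChainCosheaf I) (e.face 1)).f n).hom (hmap 1)))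
  exact congrArg (fun f : _ ⟶ cosheafHomology (dowkerChainCosheaf I) 0 => (f.f n).hom
    (orientedSimplex (restrictToCostalk e.toFace t h)))
    (costalkToHomologyZero_edge (dowkerChainCosheaf I) e)

theorem Simplex.mem_toFace_zero {K : PreAbstractSimplicialComplex G} (v : Simplex K 0) {g : G} :
    g ∈ v.toFace.1 ↔ g = v.1 0 := by
  simp [Simplex.toFace]

theorem Simplex.ext_zero {K : PreAbstractSimplicialComplex G} {v w : Simplex K 0}
    (h : v.1 0 = w.1 0) : v = w := by
  apply Subtype.ext
  ext i
  fin_cases i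
  exact h

/-- Two objects related to all of `t` always span an edge, so one gluing relation suffices and no
longer path of edges is needed. -/
theorem homologyZeroClass_eq (v w : Simplex (dowker I) 0)
    (t : OrderedSimplex (dowker (transposeRel I)) n) (hv : ∀ g ∈ v.toFace.1, ∀ i, I g (t.1 i))
    (hw : ∀ g ∈ w.toFace.1, ∀ i, I g (t.1 i)) :
    homologyZeroClass v t hv = homologyZeroClass w t hw := by
  wlog hvw : v.1 0 ≤ w.1 0 generalizing v w
  · exact (this w v hw hv (le_of_not_ge hvw)).symm
  rcases hvw.eq_or_lt with h | h
  · obtain rfl := Simplex.ext_zero h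
    rfl
  have hmono : StrictMono ![v.1 0, w.1 0] := by
    rw [Fin.strictMono_iff_lt_succ]
    intro i
    fin_cases i
    exact h
  have hI : ∀ j i, I (![v.1 0, w.1 0] j) (t.1 i) := by
    intro j i
    fin_cases j
    · exact hv _ (v.mem_toFace_zero.2 rfl) i
    · exact hw _ (w.mem_toFace_zero.2 rfl) i
  -- The attribute `t.1 0` is related to both ends, which makes them a simplex.
  let e : Simplex (dowker I) 1 := ⟨OrderEmbedding.ofStrictMono _ hmono, mem_dowker.2
    ⟨by simp, t.1 0, fun g hg => by
      obtain ⟨j, -, rfl⟩ := Finset.mem_map.1 hg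
      exact hI j 0⟩⟩
  have he : ∀ g ∈ e.toFace.1, ∀ i, I g (t.1 i) := by
    intro g hg i
    obtain ⟨j, -, rfl⟩ := Finset.mem_map.1 hg
    exact hI j i
  -- Face 0 omits the smaller vertex `v`, so what remains is `w`.
  have h0 : e.face 0 = w := Simplex.ext_zero rfl
  have h1 : e.face 1 = v := Simplex.ext_zero rfl
  have := homologyZeroClass_edge e t he
  simp only [h0, h1] at this
  exact this.symm

/-- The object witnessing that `t` is a dual simplex is itself a vertex of D(G, M, I), witnessed in
turn by `t.1 0`. -/
theorem exists_vertex (t : OrderedSimplex (dowker (transposeRel I)) n) :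
    ∃ v : Simplex (dowker I) 0, ∀ g ∈ v.toFace.1, ∀ i, I g (t.1 i) := by
  obtain ⟨-, g, hg⟩ := mem_dowker.1 t.2
  have hg' : ∀ i, I g (t.1 i) := fun i => hg _ (by simp)
  refine ⟨⟨OrderEmbedding.ofStrictMono (fun _ => g)
    (Fin.strictMono_iff_lt_succ.2 fun i => i.elim0), mem_dowker.2 ⟨by simp, t.1 0, by simpa using hg' 0⟩⟩, fun g' h => ?_⟩
  obtain rfl := (Simplex.mem_toFace_zero _).1 h
  exact hg'

/-! ### The inverse chain map -/

/-- The class of a simplex of the dual Dowker complex in the zeroth cosheaf homology. -/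
def dualClass (t : OrderedSimplex (dowker (transposeRel I)) n) :
    (cosheafHomology (dowkerChainCosheaf I) 0).X n :=
  homologyZeroClass (exists_vertex t).choose t (exists_vertex t).choose_spec

theorem dualClass_eq (v : Simplex (dowker I) 0) (t : OrderedSimplex (dowker (transposeRel I)) n)
    (h : ∀ g ∈ v.toFace.1, ∀ i, I g (t.1 i)) : dualClass t = homologyZeroClass v t h :=
  homologyZeroClass_eq ..

theorem dualClass_perm (t : OrderedSimplex (dowker (transposeRel I)) n)
    (π : Equiv.Perm (Fin (n + 1))) :
    dualClass (t.perm π) = ((Equiv.Perm.sign π : ℤ) : ℝ) • dualClass t := by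
  obtain ⟨v, hv⟩ := exists_vertex t
  -- The same `v` serves both orderings, so the sign rule of its costalk applies.
  rw [dualClass_eq v t hv, dualClass_eq v (t.perm π) (fun g hg i => hv g hg (π i))]
  exact (congrArg _ (orientedSimplex_perm (restrictToCostalk v.toFace t hv) π)).trans
    (map_smul _ _ _)

/-- The chains of the dual Dowker complex, mapped to the zeroth cosheaf homology. -/
def dualClassLinear (I : G → M → Prop) (n : ℕ) :
    OrientedChains (dowkerAsc (transposeRel I)).K n →ₗ[ℝ]
      (cosheafHomology (dowkerChainCosheaf I) 0).X n :=
  chainsLift (K := dowker (transposeRel I)) dualClass dualClass_perm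

theorem dualClassLinear_orientedSimplex (v : Simplex (dowker I) 0)
    (t : OrderedSimplex (dowkerAsc (transposeRel I)).K n)
    (h : ∀ g ∈ v.toFace.1, ∀ i, I g (t.1 i)) :
    dualClassLinear I n (orientedSimplex t) = homologyZeroClass v t h :=
  (chainsLift_orientedSimplex _ dualClass_perm t).trans (dualClass_eq v t h)

/-- A vertex that serves `t` serves all its faces, so the identity is the image of the boundary
formula in one costalk under a chain map. -/
theorem d_dualClassLinear (t : OrderedSimplex (dowkerAsc (transposeRel I)).K (n + 1)) :
    ((cosheafHomology (dowkerChainCosheaf I) 0).d (n + 1) n).hom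
      (dualClassLinear I (n + 1) (orientedSimplex t)) =
    dualClassLinear I n (boundary _ n (orientedSimplex t)) := by
  obtain ⟨v, hv⟩ := exists_vertex t
  rw [boundary_orientedSimplex, map_sum]
  refine (congrArg _ (dualClassLinear_orientedSimplex v t hv)).trans ?_
  refine (chainMap_d_apply (costalkToHomologyZero (dowkerChainCosheaf I) v) _ _ _).trans ?_
  have hd : (((dowkerChainCosheaf I).obj (Opposite.op v.toFace)).d (n + 1) n).hom
      (orientedSimplex (restrictToCostalk v.toFace t hv)) =
      ∑ i : Fin (n + 2), (-1 : ℤ) ^ (i : ℕ) •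
        orientedSimplex ((restrictToCostalk v.toFace t hv).face i) :=
    simplicialChains_d_orientedSimplex _
  refine (congrArg _ hd).trans ((map_sum _ _ _).trans (Finset.sum_congr rfl fun i _ => ?_))
  refine (map_zsmul _ _ _).trans (Eq.trans ?_ (map_zsmul _ _ _).symm)
  exact congrArg _ (dualClassLinear_orientedSimplex v (t.face i) fun g hg j => hv g hg _).symm

/-- The simplicial chain complex of the dual Dowker complex, mapped to the zeroth cosheaf
homology. -/
def dualToHomologyZero (I : G → M → Prop) :
    simplicialChains.obj (dowkerAsc (transposeRel I)) ⟶
      cosheafHomology (dowkerChainCosheaf I) 0 where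
  f n := ModuleCat.ofHom (dualClassLinear I n)
  comm' := by
    rintro _ n rfl
    rw [simplicialChains_d]
    exact ModuleCat.hom_ext (chains_hom_ext d_dualClassLinear)

theorem costalk_comp_dualToHomologyZero (v : Simplex (dowker I) 0) :
    simplicialChains.map (costalkInclusion I v.toFace) ≫ dualToHomologyZero I =
      costalkToHomologyZero (dowkerChainCosheaf I) v := by
  ext n : 1
  refine ModuleCat.hom_ext (chains_hom_ext fun t => ?_)
  refine (congrArg _ (simplicialChains_map_orientedSimplex _ t)).trans ?_
  exact dualClassLinear_orientedSimplex v _ fun g hg i => (t.1 i).2 hg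

/-- By `exists_vertex`, every oriented simplex of the dual complex is the image of one in a vertex
costalk. -/
theorem costalk_jointly_epi {A : ChainComplex (ModuleCat.{u} ℝ) ℕ}
    {f g : simplicialChains.obj (dowkerAsc (transposeRel I)) ⟶ A}
    (h : ∀ v : Simplex (dowker I) 0, simplicialChains.map (costalkInclusion I v.toFace) ≫ f =
      simplicialChains.map (costalkInclusion I v.toFace) ≫ g) : f = g := by
  ext n : 1
  refine ModuleCat.hom_ext (chains_hom_ext fun t => ?_)
  obtain ⟨v, hv⟩ := exists_vertex t
  have ht : ((simplicialChains.map (costalkInclusion I v.toFace)).f n).hom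
      (orientedSimplex (restrictToCostalk v.toFace t hv)) = orientedSimplex t :=
    simplicialChains_map_orientedSimplex _ _
  refine (congrArg _ ht.symm).trans (Eq.trans ?_ (congrArg _ ht))
  exact congrArg (fun f : _ ⟶ A => (f.f n).hom
    (orientedSimplex (restrictToCostalk v.toFace t hv))) (h v)

/-- The inclusions of the costalks into the dual Dowker complex agree along edges. -/
theorem costalkInclusion_edge (e : Simplex (dowker I) 1) (i : Fin 2) :
    (dowkerChainCosheaf I).map (homOfLE (e.toFace_face_le i)).op ≫
      simplicialChains.map (costalkInclusion I (e.face i).toFace) =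
    simplicialChains.map (costalkInclusion I e.toFace) :=
  (simplicialChains.map_comp _ _).symm

end Dual

end DowkerCosheaf

end

theorem mainTheorem4 {G M : Type u} [LinearOrder G] (I : G → M → Prop) :
    ∃ φ : cosheafHomology (dowkerChainCosheaf I) 0 ≅
        simplicialChains.obj (dowkerAsc (transposeRel I)),
      (∀ v : Simplex (dowker I) 0,
        costalkToHomologyZero (dowkerChainCosheaf I) v ≫ φ.hom =
          simplicialChains.map (costalkInclusion I v.toFace)) ∧
      ∀ n : ℕ, ∃ ψ : (cosheafHomology (dowkerChainCosheaf I) 0).homology n ≅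
          (simplicialChains.obj (dowkerAsc (transposeRel I))).homology n,
        ψ.hom = HomologicalComplex.homologyMap φ.hom n := by
  obtain ⟨f, hf⟩ := exists_homologyZero_desc (dowkerChainCosheaf I)
    (fun v => simplicialChains.map (costalkInclusion I v.toFace)) (fun e =>
      (costalkInclusion_edge e 0).trans (costalkInclusion_edge e 1).symm)
  have h1 : f ≫ dualToHomologyZero I = 𝟙 _ := homologyZero_hom_ext _ fun v => by
    rw [reassoc_of% hf, Category.comp_id]
    exact costalk_comp_dualToHomologyZero v
  have h2 : dualToHomologyZero I ≫ f = 𝟙 _ := costalk_jointly_epi fun v => by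
    rw [reassoc_of% costalk_comp_dualToHomologyZero, Category.comp_id]
    exact hf v
  let φ : cosheafHomology (dowkerChainCosheaf I) 0 ≅
      simplicialChains.obj (dowkerAsc (transposeRel I)) := ⟨f, dualToHomologyZero I, h1, h2⟩
  -- The statement on homology is functoriality applied to `φ`.
  exact ⟨φ, hf, fun n => ⟨HomologicalComplex.homologyMapIso φ n, rfl⟩⟩
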